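/- A graph is a structure $\mathsf G=\langle V;\sim\rangle$ with ${\sim}\subseteq V\times V$ an arbitrary binary relation (so graphs are directed, loops are allowed, and $V$ may be empty). A universal Horn (uH) sentence is a universally quantified formula of the form $(\Phi_1\,\&\cdots\&\,\Phi_n)\rightarrow\Phi_0$ or $\neg\Phi_0\vee\cdots\vee\neg\Phi_n$ with $n\ge 0$, where each $\Phi_i$ is atomic, i.e. of the form $x\sim y$ or $x\approx y$. A uH class is a class of graphs that contains the empty graph and is closed under isomorphic copies, induced subgraphs, direct products of nonempty families, and ultraproducts; the uH class of a class $K$ of graphs is the least uH class containing $K$. The adjacency semigroup $\mathrm A(\mathsf G)$ is the set $(V\times V)\cup\{0\}$ with the multiplication $(x,y)(z,t)=(x,t)$ if $y\sim z$ and $(x,y)(z,t)=0$ if $y\not\sim z$, $a0=0a=0$, and with the unary operation $(x,y)'=(y,x)$, $0'=0$; put $\mathrm A(K)=\{\mathrm A(\mathsf G)\mid \mathsf G\in K\}$. A variety of unary semigroups (semigroups with an additional unary operation) is a class of them closed under homomorphic images, subalgebras and direct products; identities and varieties below are those of unary semigroups. Let $K$ be any class of graphs. 1. If $K$ has no finite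 basis of uH sentences (no finite set of uH sentences has the same models as the set of all uH sentences holding in $K$), then $\mathrm A(K)$ has no finite basis of identities (no finite set of identities has the same models, among unary semigroups, as the set of all identities holding in $\mathrm A(K)$). 2. If the uH class of $K$ contains infinitely many uH classes, then the variety generated by $\mathrm A(K)$ has infinitely many subvarieties. 3. If the uH class of $K$ contains uncountably many uH classes, then the variety generated by $\mathrm A(K)$ has uncountably many subvarieties. -/

import Mathlib

universe u

/-! ## Graphs -/

/-- A graph: a set of vertices with an arbitrary binary relation on it (loops are allowed, the
relation need not be symmetric, and the vertex set may be empty). -/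
structure DirGraph : Type (u + 1) where
  V : Type u
  graph : Digraph V

namespace DirGraph

/-- The edge relation. -/
def Adj (G : DirGraph.{u}) (a b : G.V) : Prop := G.graph.Adj a b

/-- The direct product of a family of graphs. -/
def prod {I : Type u} (H : I → DirGraph.{u}) : DirGraph.{u} where
  V := ∀ i, (H i).V
  graph := { Adj := fun a b => ∀ i, (H i).Adj (a i) (b i) }

/-- The ultraproduct of a family of graphs: vertices are the classes of elements of the product
that agree on a set in the ultrafilter, and the class of `f` is joined to the class of `g` iff
`f i ∼ g i` on a set in the ultrafilter. -/
def ultraproduct {I : Type u} (U : Ultrafilter I) (H : I → DirGraph.{u}) : DirGraph.{u} where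
  V := (U : Filter I).Product fun i => (H i).V
  graph :=
    { Adj := fun a b => ∃ f g : ∀ i, (H i).V,
        a = Quotient.mk _ f ∧ b = Quotient.mk _ g ∧ ∀ᶠ i in (U : Filter I), (H i).Adj (f i) (g i) }

end DirGraph

/-- Universal Horn classes: classes of graphs closed under isomorphic copies and induced subgraphs
(`G` is isomorphic to an induced subgraph of `H` iff there is an embedding of relations), under
nonempty direct products, and under ultraproducts. Every universal Horn class contains the empty
graph, that is, the empty class is not one. -/
structure IsUHClass (L : Set DirGraph.{u}) : Prop where
  nonempty : L.Nonempty
  induced : ∀ G H : DirGraph.{u}, H ∈ L → Nonempty (G.Adj ↪r H.Adj) → G ∈ L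
  prod : ∀ (I : Type u) [Nonempty I] (H : I → DirGraph.{u}),
    (∀ i, H i ∈ L) → DirGraph.prod H ∈ L
  ultraproduct : ∀ (I : Type u) (U : Ultrafilter I) (H : I → DirGraph.{u}),
    (∀ i, H i ∈ L) → DirGraph.ultraproduct U H ∈ L

/-- The universal Horn class generated by `K`: the least one containing `K`. -/
def uhClassGenerated (K : Set DirGraph.{u}) : Set DirGraph.{u} :=
  ⋂₀ {L | IsUHClass L ∧ K ⊆ L}

/-- The sub-universal-Horn-classes of `L`. -/
def subUHClasses (L : Set DirGraph.{u}) : Set (Set DirGraph.{u}) :=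
  {M | IsUHClass M ∧ M ⊆ L}

/-! ## Universal Horn sentences -/

/-- Atomic formulas `x ∼ y` and `x ≈ y` in the language of graphs; variables are indexed by `ℕ`. -/
inductive GraphAtom : Type
  | adj (x y : ℕ) : GraphAtom
  | eq (x y : ℕ) : GraphAtom

/-- Truth of an atomic formula under an assignment. -/
def GraphAtom.Realize {G : DirGraph.{u}} (v : ℕ → G.V) : GraphAtom → Prop
  | .adj x y => G.Adj (v x) (v y)
  | .eq x y => v x = v y

/-- Universal Horn sentences. `horn [Φ₁, …, Φₙ] Φ₀` is the universally quantified
`Φ₁ & … & Φₙ → Φ₀` (with `n = 0` allowed), and `neg Φ₀ [Φ₁, …, Φₙ]` is the universally quantified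
`¬Φ₀ ∨ ¬Φ₁ ∨ … ∨ ¬Φₙ`. -/
inductive UHSentence : Type
  | horn (premises : List GraphAtom) (conclusion : GraphAtom) : UHSentence
  | neg (first : GraphAtom) (rest : List GraphAtom) : UHSentence

/-- `G ⊨ Γ`. -/
def DirGraph.Satisfies (G : DirGraph.{u}) : UHSentence → Prop
  | .horn premises conclusion =>
      ∀ v : ℕ → G.V, (∀ Φ ∈ premises, Φ.Realize v) → conclusion.Realize v
  | .neg first rest => ∀ v : ℕ → G.V, ∃ Φ ∈ first :: rest, ¬ Φ.Realize v

/-- `B` is a basis of the universal Horn sentences of `K`: its models are exactly the models of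
all universal Horn sentences that hold in every member of `K`. -/
def IsUHBasis (K : Set DirGraph.{u}) (B : Set UHSentence) : Prop :=
  ∀ G : DirGraph.{u}, (∀ Γ ∈ B, G.Satisfies Γ) ↔
    ∀ Γ : UHSentence, (∀ H ∈ K, H.Satisfies Γ) → G.Satisfies Γ

/-- `K` has a finite basis of universal Horn sentences. -/
def HasFiniteUHBasis (K : Set DirGraph.{u}) : Prop :=
  ∃ B : Set UHSentence, B.Finite ∧ IsUHBasis K B

/-! ## Unary semigroups -/

/-- A unary semigroup: a (nonempty) semigroup with an additional unary operation. -/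
structure UnarySemigroup : Type (u + 1) where
  carrier : Type u
  [semigroup : Semigroup carrier]
  [nonempty : Nonempty carrier]
  rev : carrier → carrier

namespace UnarySemigroup

instance (S : UnarySemigroup.{u}) : Semigroup S.carrier := S.semigroup
instance (S : UnarySemigroup.{u}) : Nonempty S.carrier := S.nonempty

/-- Homomorphisms of unary semigroups. -/
structure IsHom (S T : UnarySemigroup.{u}) (f : S.carrier → T.carrier) : Prop where
  map_mul : ∀ a b, f (a * b) = f a * f b
  map_rev : ∀ a, f (S.rev a) = T.rev (f a)

/-- The direct product of a family of unary semigroups. -/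
def prod {I : Type u} (S : I → UnarySemigroup.{u}) : UnarySemigroup.{u} where
  carrier := ∀ i, (S i).carrier
  rev := fun a i => (S i).rev (a i)

end UnarySemigroup

/-- Varieties of unary semigroups: classes closed under homomorphic images, under (isomorphic
copies of) subalgebras, and under direct products (including the empty product, which is the
one-element algebra). -/
structure IsUSVariety (W : Set UnarySemigroup.{u}) : Prop where
  image : ∀ S T : UnarySemigroup.{u}, S ∈ W →
    ∀ f : S.carrier → T.carrier, S.IsHom T f → Function.Surjective f → T ∈ W
  sub : ∀ S T : UnarySemigroup.{u}, T ∈ W →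
    ∀ f : S.carrier → T.carrier, S.IsHom T f → Function.Injective f → S ∈ W
  prod : ∀ (I : Type u) (S : I → UnarySemigroup.{u}),
    (∀ i, S i ∈ W) → UnarySemigroup.prod S ∈ W

/-- The variety generated by a class of unary semigroups: the least one containing it. -/
def varietyGenerated (C : Set UnarySemigroup.{u}) : Set UnarySemigroup.{u} :=
  ⋂₀ {W | IsUSVariety W ∧ C ⊆ W}

/-- The subvarieties of `W`. -/
def subvarieties (W : Set UnarySemigroup.{u}) : Set (Set UnarySemigroup.{u}) :=
  {X | IsUSVariety X ∧ X ⊆ W}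

/-- Terms in the language of unary semigroups; variables are indexed by `ℕ`. -/
inductive USTerm : Type
  | var (x : ℕ) : USTerm
  | mul (s t : USTerm) : USTerm
  | rev (s : USTerm) : USTerm

/-- The value of a term under an assignment. -/
def USTerm.eval (S : UnarySemigroup.{u}) (v : ℕ → S.carrier) : USTerm → S.carrier
  | .var x => v x
  | .mul s t => s.eval S v * t.eval S v
  | .rev s => S.rev (s.eval S v)

/-- `S ⊨ p.1 ≈ p.2`; an identity is a pair of terms. -/
def UnarySemigroup.SatisfiesIdentity (S : UnarySemigroup.{u}) (p : USTerm × USTerm) : Prop :=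
  ∀ v : ℕ → S.carrier, p.1.eval S v = p.2.eval S v

/-- `B` is an identity basis of the class `C`: the unary semigroups satisfying `B` are exactly
those satisfying all identities that hold in every member of `C`. -/
def IsIdentityBasis (C : Set UnarySemigroup.{u}) (B : Set (USTerm × USTerm)) : Prop :=
  ∀ S : UnarySemigroup.{u}, (∀ p ∈ B, S.SatisfiesIdentity p) ↔
    ∀ p : USTerm × USTerm, (∀ T ∈ C, T.SatisfiesIdentity p) → S.SatisfiesIdentity p

/-- `C` has a finite identity basis. -/
def HasFiniteIdentityBasis (C : Set UnarySemigroup.{u}) : Prop :=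
  ∃ B : Set (USTerm × USTerm), B.Finite ∧ IsIdentityBasis C B

/-! ## Adjacency semigroups -/

/-- The underlying set `(V × V) ∪ {0}` of the adjacency semigroup. -/
inductive AdjElem (V : Type u) : Type u
  | zero : AdjElem V
  | pair (x y : V) : AdjElem V

open Classical in
/-- `(x, y)(z, t)` is `(x, t)` if `y ∼ z` and `0` otherwise; `a0 = 0a = 0`. -/
noncomputable def AdjElem.mul (G : DirGraph.{u}) : AdjElem G.V → AdjElem G.V → AdjElem G.V
  | .pair x y, .pair z t => if G.Adj y z then .pair x t else .zero
  | _, _ => .zero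

/-- Reversion: `(x, y)' = (y, x)` and `0' = 0`. -/
def AdjElem.rev {V : Type u} : AdjElem V → AdjElem V
  | .zero => .zero
  | .pair x y => .pair y x

theorem AdjElem.mul_assoc (G : DirGraph.{u}) (a b c : AdjElem G.V) :
    AdjElem.mul G (AdjElem.mul G a b) c = AdjElem.mul G a (AdjElem.mul G b c) := by
  classical
  rcases a with _ | ⟨a₁, a₂⟩ <;> rcases b with _ | ⟨b₁, b₂⟩ <;> rcases c with _ | ⟨c₁, c₂⟩ <;>
    simp only [AdjElem.mul] <;> split_ifs <;> simp_all

/-- The adjacency semigroup `A(G)` of a graph `G`, with reversion. -/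
noncomputable def adjacencySemigroup (G : DirGraph.{u}) : UnarySemigroup.{u} where
  carrier := AdjElem G.V
  semigroup := { mul := AdjElem.mul G, mul_assoc := AdjElem.mul_assoc G }
  nonempty := ⟨AdjElem.zero⟩
  rev := AdjElem.rev

/-- The class `A(K)` of the adjacency semigroups of the members of `K`. -/
def adjacencyClass (K : Set DirGraph.{u}) : Set UnarySemigroup.{u} :=
  adjacencySemigroup '' K

-- Everything rests on a translation between identities of `A(G)` and universal Horn sentences of
-- `G`. An assignment of nonzero values amounts to two vertices for each variable. A term then takes
-- the value (first vertex, last vertex) if certain edges are present among these vertices, and 0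
-- otherwise. Hence an identity says the same as finitely many universal Horn sentences
-- (`exists_uhSentences_of_identity`).
--
-- Conversely, once the equations in the premises are removed by identifying variables, the premises
-- form a list of edges. A nonempty list is encoded by `premiseTerm`. Comparing this term with its
-- reverse, its reverse with the square of the reverse, or the term with its product by a fresh
-- variable expresses an equation, an edge or a contradiction as conclusion
-- (`exists_identity_of_uhSentence`). A finite identity basis of `A(K)` therefore yields a finite
-- basis of universal Horn sentences of `K`.
--
-- For the counting statements, `M` is sent to the variety generated by `A(M)`. This variety lies
-- inside that of `A(K)`, because for every variety `W` the graphs with `A(G)` in `W` form a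
-- universal Horn class (`isUHClass_adjacencySemigroup_mem`); the point is that `A` of a reduced
-- product is a homomorphic image of the product of the `A(H i)`. The map is injective, because a
-- universal Horn class is determined by its universal Horn sentences
-- (`IsUHClass.mem_of_satisfies`), and the identities of `A(M)` determine those.

/-! ## Terms over adjacency semigroups -/

/-- All edges in the list `E` are present under the assignment `g`. -/
def EdgesHold (G : DirGraph.{u}) (g : ℕ → G.V) (E : List (ℕ × ℕ)) : Prop :=
  ∀ e ∈ E, G.Adj (g e.1) (g e.2)

theorem edgesHold_nil (G : DirGraph.{u}) (g : ℕ → G.V) : EdgesHold G g [] := by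
  simp [EdgesHold]

theorem edgesHold_append (G : DirGraph.{u}) (g : ℕ → G.V) (E F : List (ℕ × ℕ)) :
    EdgesHold G g (E ++ F) ↔ EdgesHold G g E ∧ EdgesHold G g F := by
  simp [EdgesHold, or_imp, forall_and]

theorem edgesHold_cons (G : DirGraph.{u}) (g : ℕ → G.V) (e : ℕ × ℕ) (E : List (ℕ × ℕ)) :
    EdgesHold G g (e :: E) ↔ G.Adj (g e.1) (g e.2) ∧ EdgesHold G g E := by
  simp [EdgesHold]

namespace USTerm

/-- The variables of a term. -/
def vars : USTerm → Finset ℕ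
  | .var x => {x}
  | .mul s t => s.vars ∪ t.vars
  | .rev s => s.vars

mutual
/-- The left vertex of the value of a term; the variable `x` has the vertices `2x` and `2x+1`. -/
def first : USTerm → ℕ
  | .var x => 2 * x
  | .mul s _ => s.first
  | .rev s => s.last
/-- The right vertex of the value of a term. -/
def last : USTerm → ℕ
  | .var x => 2 * x + 1
  | .mul _ t => t.last
  | .rev s => s.first
end

/-- The edges required for the value of a term to be nonzero. -/
def conds : USTerm → List (ℕ × ℕ)
  | .var _ => []
  | .mul s t => s.conds ++ t.conds ++ [(s.last, t.first)]
  | .rev s => s.conds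

end USTerm

/-- The value of a term in the adjacency semigroup. -/
noncomputable def adjEval (G : DirGraph.{u}) (v : ℕ → AdjElem G.V) : USTerm → AdjElem G.V
  | .var x => v x
  | .mul s t => AdjElem.mul G (adjEval G v s) (adjEval G v t)
  | .rev s => (adjEval G v s).rev

theorem eval_adjacencySemigroup (G : DirGraph.{u}) (v : ℕ → AdjElem G.V) (t : USTerm) :
    t.eval (adjacencySemigroup G) v = adjEval G v t := by
  induction t with
  | var x => rfl
  | mul s t ihs iht => exact congrArg₂ (AdjElem.mul G) ihs iht
  | rev s ih => exact congrArg AdjElem.rev ih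

theorem satisfiesIdentity_iff_adjEval (G : DirGraph.{u}) (s t : USTerm) :
    (adjacencySemigroup G).SatisfiesIdentity (s, t) ↔
      ∀ v : ℕ → AdjElem G.V, adjEval G v s = adjEval G v t :=
  forall_congr' fun v =>
    Eq.congr (eval_adjacencySemigroup G v s) (eval_adjacencySemigroup G v t)

theorem AdjElem.zero_mul (G : DirGraph.{u}) (a : AdjElem G.V) :
    AdjElem.mul G .zero a = .zero := rfl

theorem AdjElem.mul_zero (G : DirGraph.{u}) (a : AdjElem G.V) :
    AdjElem.mul G a .zero = .zero := by
  cases a <;> rfl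

/-- The nonzero assignment with given vertices. -/
def pairAssign (G : DirGraph.{u}) (g : ℕ → G.V) : ℕ → AdjElem G.V :=
  fun n => AdjElem.pair (g (2 * n)) (g (2 * n + 1))

theorem adjEval_pairAssign (G : DirGraph.{u}) (g : ℕ → G.V) (t : USTerm) :
    (EdgesHold G g t.conds →
      adjEval G (pairAssign G g) t = AdjElem.pair (g t.first) (g t.last)) ∧
    (¬ EdgesHold G g t.conds →
      adjEval G (pairAssign G g) t = AdjElem.zero) := by
  classical
  induction t with
  | var x => exact ⟨fun _ => rfl, fun h => absurd (edgesHold_nil G g) h⟩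
  | rev s ih =>
    simp only [adjEval, USTerm.conds, USTerm.first, USTerm.last]
    refine ⟨fun h => ?_, fun h => ?_⟩
    · rw [ih.1 h]; rfl
    · rw [ih.2 h]; rfl
  | mul s t ihs iht =>
    simp only [adjEval, USTerm.conds, USTerm.first, USTerm.last, edgesHold_append,
      edgesHold_cons]
    by_cases hs : EdgesHold G g s.conds
    · by_cases ht : EdgesHold G g t.conds
      · rw [ihs.1 hs, iht.1 ht]
        simp only [AdjElem.mul]
        by_cases h : G.Adj (g s.last) (g t.first)
        · simp [hs, ht, h, edgesHold_nil]
        · simp [h]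
      · rw [iht.2 ht, AdjElem.mul_zero]
        simp [ht]
    · rw [ihs.2 hs, AdjElem.zero_mul]
      simp [hs]

theorem adjEval_eq_zero (G : DirGraph.{u}) (v : ℕ → AdjElem G.V) (t : USTerm)
    {x : ℕ} (hx : x ∈ t.vars) (hv : v x = AdjElem.zero) :
    adjEval G v t = AdjElem.zero := by
  induction t with
  | var y => simp only [USTerm.vars, Finset.mem_singleton] at hx; subst hx; exact hv
  | rev s ih => rw [adjEval, ih hx]; rfl
  | mul s t ihs iht =>
    simp only [USTerm.vars, Finset.mem_union] at hx
    rw [adjEval]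
    rcases hx with hx | hx
    · rw [ihs hx]; rfl
    · rw [iht hx, AdjElem.mul_zero]

theorem adjEval_congr (G : DirGraph.{u}) (v w : ℕ → AdjElem G.V) (t : USTerm)
    (h : ∀ x ∈ t.vars, v x = w x) : adjEval G v t = adjEval G w t := by
  induction t with
  | var y => exact h y (by simp [USTerm.vars])
  | rev s ih => simp only [adjEval]; rw [ih h]
  | mul s t ihs iht =>
    simp only [USTerm.vars, Finset.mem_union] at h
    simp only [adjEval]
    rw [ihs fun x hx => h x (.inl hx), iht fun x hx => h x (.inr hx)]

theorem USTerm.vars_nonempty (t : USTerm) : t.vars.Nonempty := by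
  induction t with
  | var y => simp [USTerm.vars]
  | rev s ih => exact ih
  | mul s t ihs _ => exact ihs.mono Finset.subset_union_left

/-- An assignment that is nonzero on the variables of a term agrees there with one that is nonzero
everywhere. -/
theorem exists_pairAssign (G : DirGraph.{u}) (v : ℕ → AdjElem G.V)
    {A : Finset ℕ} (hA : A.Nonempty) (hv : ∀ x ∈ A, v x ≠ AdjElem.zero) :
    ∃ g : ℕ → G.V, ∀ x ∈ A, v x = pairAssign G g x := by
  obtain ⟨x₀, hx₀⟩ := hA
  have key : ∀ x, ∃ p : G.V × G.V, x ∈ A → v x = AdjElem.pair p.1 p.2 := by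
    -- The vertices of `v x₀` serve as default outside `A`; without a nonzero value there might be
    -- no vertex at all.
    have h0 : ∃ p : G.V × G.V, v x₀ = AdjElem.pair p.1 p.2 := by
      rcases h : v x₀ with _ | ⟨a, b⟩
      · exact absurd h (hv x₀ hx₀)
      · exact ⟨(a, b), rfl⟩
    intro x
    by_cases hx : x ∈ A
    · rcases h : v x with _ | ⟨a, b⟩
      · exact absurd h (hv x hx)
      · exact ⟨(a, b), fun _ => rfl⟩
    · exact ⟨h0.choose, fun h => absurd h hx⟩
  choose p hp using key
  refine ⟨fun n => if n % 2 = 0 then (p (n / 2)).1 else (p (n / 2)).2, fun x hx => ?_⟩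
  rw [hp x hx]
  have h1 : (2 * x + 1) / 2 = x := by omega
  have h2 : (2 * x + 1) % 2 = 1 := by omega
  simp [pairAssign, h1, h2]

/-! ## Identities as universal Horn sentences -/

/-- A zero among the common variables annihilates both sides, so only assignments coming from
vertices matter. -/
theorem satisfiesIdentity_iff_of_vars_eq (G : DirGraph.{u}) (s t : USTerm)
    (h : s.vars = t.vars) :
    (adjacencySemigroup G).SatisfiesIdentity (s, t) ↔ ∀ g : ℕ → G.V,
      (EdgesHold G g s.conds ↔ EdgesHold G g t.conds) ∧
      (EdgesHold G g s.conds → g s.first = g t.first ∧ g s.last = g t.last) := by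
  rw [satisfiesIdentity_iff_adjEval]
  constructor
  · intro H g
    have Hg := H (pairAssign G g)
    have es := adjEval_pairAssign G g s
    have et := adjEval_pairAssign G g t
    by_cases hs : EdgesHold G g s.conds <;> by_cases ht : EdgesHold G g t.conds
    · rw [es.1 hs, et.1 ht] at Hg
      cases (AdjElem.pair.injEq _ _ _ _).mp Hg
      simp_all
    · rw [es.1 hs, et.2 ht] at Hg
      cases Hg
    · rw [es.2 hs, et.1 ht] at Hg
      cases Hg
    · simp [hs, ht]
  · intro H v
    by_cases hz : ∃ x ∈ s.vars, v x = AdjElem.zero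
    · obtain ⟨x, hx, hv⟩ := hz
      rw [adjEval_eq_zero G v s hx hv, adjEval_eq_zero G v t (h ▸ hx) hv]
    · push Not at hz
      obtain ⟨g, hg⟩ := exists_pairAssign G v s.vars_nonempty hz
      rw [adjEval_congr _ v _ s hg, adjEval_congr _ v _ t (h ▸ hg)]
      obtain ⟨h1, h2⟩ := H g
      by_cases hs : EdgesHold G g s.conds
      · rw [(adjEval_pairAssign G g s).1 hs, (adjEval_pairAssign G g t).1 (h1.1 hs), (h2 hs).1,
          (h2 hs).2]
      · rw [(adjEval_pairAssign G g s).2 hs, (adjEval_pairAssign G g t).2 (fun h => hs (h1.2 h))]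

theorem adjEval_eq_zero_of_forall_not (G : DirGraph.{u}) (t : USTerm)
    (H : ∀ g : ℕ → G.V, ¬ EdgesHold G g t.conds) (v : ℕ → AdjElem G.V) :
    adjEval G v t = AdjElem.zero := by
  by_cases hz : ∃ x ∈ t.vars, v x = AdjElem.zero
  · obtain ⟨x, hx, hv⟩ := hz
    exact adjEval_eq_zero G v t hx hv
  · push Not at hz
    obtain ⟨g, hg⟩ := exists_pairAssign G v t.vars_nonempty hz
    rw [adjEval_congr _ v _ t hg, (adjEval_pairAssign G g t).2 (H g)]

theorem forall_not_of_forall_adjEval_eq_zero (G : DirGraph.{u}) (t : USTerm)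
    (H : ∀ v : ℕ → AdjElem G.V,
      adjEval G v t = AdjElem.zero) (g : ℕ → G.V) :
    ¬ EdgesHold G g t.conds := by
  intro h
  have := (adjEval_pairAssign G g t).1 h
  rw [H] at this
  cases this

/-- Resetting `x` to 0 annihilates `s` and leaves `t` unchanged. -/
theorem forall_adjEval_eq_zero_of_notMem (G : DirGraph.{u}) (s t : USTerm)
    (H : ∀ v, adjEval G v s = adjEval G v t)
    {x : ℕ} (hx : x ∈ s.vars) (hxt : x ∉ t.vars) (v : ℕ → AdjElem G.V) :
    adjEval G v t = AdjElem.zero := by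
  classical
  rw [adjEval_congr _ v (fun y => if y = x then .zero else v y) t, ← H]
  · exact adjEval_eq_zero G _ s hx (if_pos rfl)
  · intro y hy
    exact (if_neg fun h : y = x => hxt (h ▸ hy)).symm

theorem satisfiesIdentity_iff_of_vars_ne (G : DirGraph.{u}) (s t : USTerm)
    (h : s.vars ≠ t.vars) :
    (adjacencySemigroup G).SatisfiesIdentity (s, t) ↔ ∀ g : ℕ → G.V,
      ¬ EdgesHold G g s.conds ∧ ¬ EdgesHold G g t.conds := by
  rw [satisfiesIdentity_iff_adjEval]
  constructor
  · intro H
    have hex : (∃ x ∈ s.vars, x ∉ t.vars) ∨ (∃ x ∈ t.vars, x ∉ s.vars) := by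
      by_contra! hc
      exact h (Finset.Subset.antisymm hc.1 hc.2)
    have hzero : ∀ v, adjEval G v t = AdjElem.zero := by
      rcases hex with ⟨x, hx, hx'⟩ | ⟨x, hx, hx'⟩
      · exact forall_adjEval_eq_zero_of_notMem G s t H hx hx'
      · intro v
        rw [← H]
        exact forall_adjEval_eq_zero_of_notMem G t s (fun v => (H v).symm) hx hx' v
    exact fun g => ⟨forall_not_of_forall_adjEval_eq_zero G s (fun v => (H v).trans (hzero v)) g,
      forall_not_of_forall_adjEval_eq_zero G t hzero g⟩
  · intro H v
    rw [adjEval_eq_zero_of_forall_not G s (fun g => (H g).1),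
      adjEval_eq_zero_of_forall_not G t (fun g => (H g).2)]

theorem GraphAtom.realize_adj {G : DirGraph.{u}} (v : ℕ → G.V) (x y : ℕ) :
    (GraphAtom.adj x y).Realize v ↔ G.Adj (v x) (v y) := Iff.rfl

theorem GraphAtom.realize_eq {G : DirGraph.{u}} (v : ℕ → G.V) (x y : ℕ) :
    (GraphAtom.eq x y).Realize v ↔ v x = v y := Iff.rfl

/-- A list of edges as a list of atomic formulas. -/
def edgeAtoms (E : List (ℕ × ℕ)) : List GraphAtom := E.map fun e => .adj e.1 e.2

theorem forall_edgeAtoms (G : DirGraph.{u}) (g : ℕ → G.V) (E : List (ℕ × ℕ)) :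
    (∀ Φ ∈ edgeAtoms E, Φ.Realize g) ↔ EdgesHold G g E :=
  List.forall_mem_map

theorem satisfies_neg_iff (G : DirGraph.{u}) (Φ : GraphAtom) (P : List GraphAtom) :
    G.Satisfies (.neg Φ P) ↔ ∀ v : ℕ → G.V, ¬ ∀ Ψ ∈ Φ :: P, Ψ.Realize v := by
  simp only [DirGraph.Satisfies, not_forall, exists_prop]

/-- The trivially true atom `.eq 0 0` is a filler: a negative sentence needs at least one atom,
while `E` may be empty. -/
theorem satisfies_neg_edgeAtoms (G : DirGraph.{u}) (E : List (ℕ × ℕ)) :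
    G.Satisfies (.neg (.eq 0 0) (edgeAtoms E)) ↔ ∀ g : ℕ → G.V, ¬ EdgesHold G g E := by
  simp only [satisfies_neg_iff, List.forall_mem_cons, forall_edgeAtoms]
  simp [GraphAtom.realize_eq]

theorem satisfies_horn_edgeAtoms (G : DirGraph.{u}) (E : List (ℕ × ℕ)) (Φ : GraphAtom) :
    G.Satisfies (.horn (edgeAtoms E) Φ) ↔ ∀ g : ℕ → G.V, EdgesHold G g E → Φ.Realize g := by
  simp only [DirGraph.Satisfies, forall_edgeAtoms]

/-- The universal Horn sentences with the premises `E` and a conclusion in `P`. -/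
def hornSet (E : List (ℕ × ℕ)) (P : List GraphAtom) : Set UHSentence :=
  {Γ | ∃ Φ ∈ P, Γ = .horn (edgeAtoms E) Φ}

theorem hornSet_finite (E : List (ℕ × ℕ)) (P : List GraphAtom) : (hornSet E P).Finite := by
  refine ((List.finite_toSet P).image fun Φ => UHSentence.horn (edgeAtoms E) Φ).subset ?_
  rintro Γ ⟨Φ, h, rfl⟩
  exact ⟨Φ, h, rfl⟩

theorem forall_hornSet (G : DirGraph.{u}) (E : List (ℕ × ℕ)) (P : List GraphAtom) :
    (∀ Γ ∈ hornSet E P, G.Satisfies Γ) ↔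
      ∀ g : ℕ → G.V, EdgesHold G g E → ∀ Φ ∈ P, Φ.Realize g := by
  constructor
  · intro H g hg Φ hΦ
    exact (satisfies_horn_edgeAtoms G E Φ).1 (H _ ⟨Φ, hΦ, rfl⟩) g hg
  · rintro H _ ⟨Φ, hΦ, rfl⟩
    exact (satisfies_horn_edgeAtoms G E Φ).2 fun g hg => H g hg Φ hΦ

/-- An identity holds in `A(G)` iff a certain finite set of universal Horn sentences holds
in `G`. -/
theorem exists_uhSentences_of_identity (p : USTerm × USTerm) :
    ∃ B : Set UHSentence, B.Finite ∧ ∀ G : DirGraph.{u},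
      (∀ Γ ∈ B, G.Satisfies Γ) ↔ (adjacencySemigroup G).SatisfiesIdentity p := by
  obtain ⟨s, t⟩ := p
  by_cases h : s.vars = t.vars
  · refine ⟨hornSet s.conds
      (.eq s.first t.first :: .eq s.last t.last :: edgeAtoms t.conds) ∪
        hornSet t.conds (edgeAtoms s.conds),
      (hornSet_finite _ _).union (hornSet_finite _ _), fun G => ?_⟩
    simp only [Set.mem_union, or_imp, forall_and, forall_hornSet, List.forall_mem_cons,
      forall_edgeAtoms, satisfiesIdentity_iff_of_vars_eq G s t h, GraphAtom.realize_eq]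
    constructor
    · rintro ⟨⟨h1, h2, h3⟩, h4⟩
      exact ⟨fun g => ⟨h3 g, h4 g⟩, h1, h2⟩
    · rintro ⟨h1, h2, h3⟩
      exact ⟨⟨h2, h3, fun g => (h1 g).1⟩, fun g => (h1 g).2⟩
  · refine ⟨{.neg (.eq 0 0) (edgeAtoms s.conds), .neg (.eq 0 0) (edgeAtoms t.conds)},
      by simp, fun G => ?_⟩
    simp only [Set.mem_insert_iff, Set.mem_singleton_iff, forall_eq_or_imp, forall_eq,
      satisfies_neg_edgeAtoms, satisfiesIdentity_iff_of_vars_ne G s t h, forall_and]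

/-! ## Universal Horn sentences as identities -/

/-- Equations can be eliminated from a conjunction of atomic formulas by identifying variables. -/
theorem exists_eliminate_eq (P : List GraphAtom) : ∃ (q : ℕ → ℕ) (E : List (ℕ × ℕ)),
    ∀ (G : DirGraph.{u}) (v : ℕ → G.V),
      ((∀ Φ ∈ P, Φ.Realize v) → v ∘ q = v ∧ EdgesHold G v E) ∧
      (EdgesHold G v E → ∀ Φ ∈ P, Φ.Realize (v ∘ q)) := by
  induction P with
  | nil => exact ⟨id, [], fun G v => by simp [edgesHold_nil]⟩
  | cons Φ P ih =>
    obtain ⟨q, E, ih⟩ := ih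
    cases Φ with
    | adj x y =>
      refine ⟨q, (q x, q y) :: E, fun G v => ?_⟩
      simp only [List.forall_mem_cons, edgesHold_cons, GraphAtom.realize_adj]
      refine ⟨fun ⟨h1, h2⟩ => ?_, fun ⟨h1, h2⟩ => ⟨h1, (ih G v).2 h2⟩⟩
      obtain ⟨h3, h4⟩ := (ih G v).1 h2
      refine ⟨h3, ?_, h4⟩
      have hx := congrFun h3 x
      have hy := congrFun h3 y
      simp only [Function.comp] at hx hy
      rwa [hx, hy]
    | eq x y =>
      -- The earlier equations have already renamed `x` and `y` to `q x` and `q y`, so these two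
      -- representatives are merged, also in the edges.
      refine ⟨(fun n => if n = q x then q y else n) ∘ q,
        E.map fun e => (if e.1 = q x then q y else e.1, if e.2 = q x then q y else e.2),
        fun G v => ?_⟩
      have hE : EdgesHold G v (E.map fun e =>
          (if e.1 = q x then q y else e.1, if e.2 = q x then q y else e.2)) ↔
          EdgesHold G (v ∘ fun n => if n = q x then q y else n) E :=
        List.forall_mem_map
      rw [hE]
      simp only [List.forall_mem_cons]
      constructor
      · rintro ⟨h1, h2⟩
        obtain ⟨h3, h4⟩ := (ih G v).1 h2
        have hx : v (q x) = v x := congrFun h3 x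
        have hy : v (q y) = v y := congrFun h3 y
        have hr : (v ∘ fun n => if n = q x then q y else n) = v := by
          funext n
          simp only [Function.comp]
          split_ifs with hn
          · rw [hn, hx, hy]; exact h1.symm
          · rfl
        rw [← Function.comp_assoc, hr]
        exact ⟨h3, h4⟩
      · intro h
        rw [← Function.comp_assoc]
        refine ⟨?_, (ih G _).2 h⟩
        simp only [GraphAtom.realize_eq, Function.comp]
        split_ifs <;> simp_all

/-- The term whose value is the left vertex of the variable `w + 2` paired with the left vertex of the
variable `0`, provided that the edges `E` between the left vertices of the shifted variables are
present. The other conditions only concern right vertices and the variable `0`. -/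
def chainTerm (w : ℕ) : List (ℕ × ℕ) → USTerm
  | [] => .rev (.mul (.var 0) (.rev (.var (w + 2))))
  | e :: E => .rev (.mul (.var 0)
      (.rev (.mul (chainTerm w E) (.mul (.rev (.var (e.1 + 2))) (.var (e.2 + 2))))))

theorem chainTerm_first_last (w : ℕ) (E : List (ℕ × ℕ)) :
    (chainTerm w E).first = 2 * (w + 2) ∧ (chainTerm w E).last = 0 := by
  induction E with
  | nil => simp [chainTerm, USTerm.first, USTerm.last]
  | cons e E ih => simp [chainTerm, USTerm.first, USTerm.last, ih.1]

/-- Each edge enters as a factor `x'y`, whose inner edge joins left vertices and whose outer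
vertices are right ones. Multiplying by the variable `0` under reversion restores the right end to
`g 0`, so the next factor can be attached in the same way. -/
theorem chainTerm_conds (G : DirGraph.{u}) (g : ℕ → G.V) (w : ℕ) (E : List (ℕ × ℕ)) :
    EdgesHold G g (chainTerm w E).conds ↔ G.Adj (g 1) (g (2 * (w + 2) + 1)) ∧
      ∀ e ∈ E, G.Adj (g (2 * (e.1 + 2))) (g (2 * (e.2 + 2))) ∧
        G.Adj (g 0) (g (2 * (e.1 + 2) + 1)) ∧ G.Adj (g 1) (g (2 * (e.2 + 2) + 1)) := by
  induction E with
  | nil => simp [chainTerm, USTerm.conds, EdgesHold, USTerm.first, USTerm.last]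
  | cons e E ih =>
    simp only [chainTerm, USTerm.conds, edgesHold_append, ih, USTerm.first, USTerm.last,
      edgesHold_cons, edgesHold_nil, (chainTerm_first_last w E).2, List.forall_mem_cons]
    tauto

/-- The shift by 2 keeps the variable `1` fresh; negative sentences are expressed with it. -/
theorem chainTerm_vars (w : ℕ) (E : List (ℕ × ℕ)) : 1 ∉ (chainTerm w E).vars := by
  induction E with
  | nil => simp [chainTerm, USTerm.vars]
  | cons e E ih => simp [chainTerm, USTerm.vars, ih]

/-- The term whose value is the pair of left vertices of the shifted variables `x` and `y`,
provided that the edges `E` are present. -/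
def premiseTerm (x y : ℕ) (E : List (ℕ × ℕ)) : USTerm :=
  .mul (chainTerm x E) (.rev (.var (y + 2)))

theorem premiseTerm_first (x y : ℕ) (E : List (ℕ × ℕ)) :
    (premiseTerm x y E).first = 2 * (x + 2) :=
  (chainTerm_first_last x E).1

theorem premiseTerm_last (x y : ℕ) (E : List (ℕ × ℕ)) :
    (premiseTerm x y E).last = 2 * (y + 2) := rfl

theorem premiseTerm_vars (x y : ℕ) (E : List (ℕ × ℕ)) : 1 ∉ (premiseTerm x y E).vars := by
  simp [premiseTerm, USTerm.vars, chainTerm_vars]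

theorem edgesHold_of_premiseTerm (G : DirGraph.{u}) (g : ℕ → G.V) (x y : ℕ)
    (E : List (ℕ × ℕ)) (h : EdgesHold G g (premiseTerm x y E).conds) :
    EdgesHold G (fun n => g (2 * (n + 2))) E := by
  simp only [premiseTerm, USTerm.conds, edgesHold_append, chainTerm_conds] at h
  exact fun e he => (h.1.1.2 e he).1

/-- Every assignment satisfying a nonempty list of edges extends to one satisfying the conditions
of `premiseTerm`. -/
theorem exists_premiseTerm_conds (G : DirGraph.{u}) (v : ℕ → G.V) {E : List (ℕ × ℕ)}
    (hE : E ≠ []) (h : EdgesHold G v E) :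
    ∃ g : ℕ → G.V, (∀ n, g (2 * (n + 2)) = v n) ∧
      ∀ x y, EdgesHold G g (premiseTerm x y E).conds := by
  obtain ⟨e, he⟩ := List.exists_mem_of_ne_nil E hE
  have hcd := h e he
  -- Both vertices of the variable `0` go to the source of one chosen edge and all other right
  -- vertices to its target, so every auxiliary condition becomes that edge.
  let g : ℕ → G.V := fun n =>
    if n ≤ 1 then v e.1 else if n % 2 = 0 then v (n / 2 - 2) else v e.2
  have h0 : g 0 = v e.1 := rfl
  have h1 : g 1 = v e.1 := rfl
  have heven : ∀ n, g (2 * (n + 2)) = v n := by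
    intro n
    have a1 : ¬ 2 * (n + 2) ≤ 1 := by omega
    simp [g, a1]
  have hodd : ∀ n, g (2 * (n + 2) + 1) = v e.2 := by
    intro n
    have a1 : ¬ 2 * (n + 2) + 1 ≤ 1 := by omega
    have a2 : ¬ (2 * (n + 2) + 1) % 2 = 0 := by omega
    simp only [g, if_neg a1, if_neg a2]
  refine ⟨g, heven, fun x y => ?_⟩
  simp only [premiseTerm, USTerm.conds, edgesHold_append, chainTerm_conds, USTerm.first,
    USTerm.last, edgesHold_cons, edgesHold_nil, (chainTerm_first_last x E).2, h0, h1, heven, hodd]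
  exact ⟨⟨⟨hcd, fun f hf => ⟨h f hf, hcd, hcd⟩⟩, trivial⟩, hcd, trivial⟩

theorem exists_identity_of_edges_imp_adj (E : List (ℕ × ℕ)) (x y : ℕ) :
    ∃ p : USTerm × USTerm, ∀ G : DirGraph.{u}, (adjacencySemigroup G).SatisfiesIdentity p ↔
      ∀ v : ℕ → G.V, EdgesHold G v E → G.Adj (v x) (v y) := by
  by_cases hE : E = []
  · subst hE
    by_cases hxy : x = y
    · subst hxy
      -- The identity `z ≈ zz'z` requires loops at both vertices of `z`, hence at every vertex.
      refine ⟨(.var 0, .mul (.mul (.var 0) (.rev (.var 0))) (.var 0)), fun G => ?_⟩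
      rw [satisfiesIdentity_iff_of_vars_eq _ _ _ (by simp [USTerm.vars])]
      simp only [USTerm.conds, edgesHold_append, edgesHold_nil, edgesHold_cons, USTerm.first,
        USTerm.last]
      constructor
      · intro H v _
        simpa using (H (fun _ => v x)).1
      · intro H g
        have h0 := H (fun _ => g 0) trivial
        have h1 := H (fun _ => g 1) trivial
        simp_all
    · refine ⟨(.rev (.var 0), .mul (.rev (.var 0)) (.rev (.var 0))), fun G => ?_⟩
      rw [satisfiesIdentity_iff_of_vars_eq _ _ _ (by simp [USTerm.vars])]
      simp only [USTerm.conds, edgesHold_append, edgesHold_nil, edgesHold_cons, USTerm.first,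
        USTerm.last]
      constructor
      · intro H v _
        simpa using (H (fun n => if n = 0 then v x else v y)).1
      · intro H g
        have h0 : G.Adj (g 0) (g 1) := by
          simpa [Ne.symm hxy] using H (fun n => if n = x then g 0 else g 1) trivial
        simpa using h0
  -- The nonzero values of the reversed term are pairs with left vertex for `y` and right vertex for
  -- `x`; the square of such a pair is nonzero exactly when the edge from `x` to `y` is present.
  · refine ⟨(.rev (premiseTerm x y E),
      .mul (.rev (premiseTerm x y E)) (.rev (premiseTerm x y E))), fun G => ?_⟩
    rw [satisfiesIdentity_iff_of_vars_eq _ _ _ (by simp [USTerm.vars])]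
    simp only [USTerm.conds, edgesHold_append, edgesHold_nil, edgesHold_cons, USTerm.first,
        USTerm.last, premiseTerm_first, premiseTerm_last]
    constructor
    · intro H v hv
      obtain ⟨g, h1, h2⟩ := exists_premiseTerm_conds G v hE hv
      have := ((H g).1.1 (h2 x y)).2.1
      rwa [h1, h1] at this
    · intro H g
      have := fun h => H _ (edgesHold_of_premiseTerm G g x y E h)
      tauto

theorem exists_identity_of_edges_imp_eq (E : List (ℕ × ℕ)) (x y : ℕ) :
    ∃ p : USTerm × USTerm, ∀ G : DirGraph.{u}, (adjacencySemigroup G).SatisfiesIdentity p ↔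
      ∀ v : ℕ → G.V, EdgesHold G v E → v x = v y := by
  by_cases hxy : x = y
  · exact ⟨(.var 0, .var 0), fun G => ⟨fun _ v _ => by rw [hxy], fun _ _ => rfl⟩⟩
  by_cases hE : E = []
  · subst hE
    refine ⟨(.var 0, .rev (.var 0)), fun G => ?_⟩
    rw [satisfiesIdentity_iff_of_vars_eq _ _ _ (by simp [USTerm.vars])]
    simp only [USTerm.conds, edgesHold_nil, USTerm.first, USTerm.last]
    constructor
    · intro H v _
      exact ((H (fun n => if n = 0 then v x else v y)).2 trivial).1
    · intro H g
      have h0 : g 0 = g 1 := by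
        simpa [Ne.symm hxy] using H (fun n => if n = x then g 0 else g 1) trivial
      simpa using ⟨h0, h0.symm⟩
  -- A nonzero pair equals its reverse exactly when its two vertices coincide.
  · refine ⟨(premiseTerm x y E, .rev (premiseTerm x y E)), fun G => ?_⟩
    rw [satisfiesIdentity_iff_of_vars_eq _ _ _ (by simp [USTerm.vars])]
    simp only [USTerm.conds, USTerm.first, USTerm.last, premiseTerm_first, premiseTerm_last]
    constructor
    · intro H v hv
      obtain ⟨g, h1, h2⟩ := exists_premiseTerm_conds G v hE hv
      have := ((H g).2 (h2 x y)).1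
      rwa [h1, h1] at this
    · intro H g
      have := fun h => H _ (edgesHold_of_premiseTerm G g x y E h)
      exact ⟨trivial, fun h => ⟨this h, (this h).symm⟩⟩

/-- An identity `t ≈ tz` with `z` not in `t` forces `t` to vanish identically. For empty `E`, taking
`t` to be a variable forces the graph to be empty. -/
theorem exists_identity_of_not_edges (E : List (ℕ × ℕ)) :
    ∃ p : USTerm × USTerm, ∀ G : DirGraph.{u}, (adjacencySemigroup G).SatisfiesIdentity p ↔
      ∀ v : ℕ → G.V, ¬ EdgesHold G v E := by
  by_cases hE : E = []
  · subst hE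
    refine ⟨(.var 0, .mul (.var 0) (.var 1)), fun G => ?_⟩
    rw [satisfiesIdentity_iff_of_vars_ne _ _ _ (by decide)]
    simp only [USTerm.conds, edgesHold_nil]
    simp
  · refine ⟨(premiseTerm 0 0 E, .mul (premiseTerm 0 0 E) (.var 1)), fun G => ?_⟩
    rw [satisfiesIdentity_iff_of_vars_ne]
    · simp only [USTerm.conds, edgesHold_append]
      constructor
      · intro H v hv
        obtain ⟨g, _, h2⟩ := exists_premiseTerm_conds G v hE hv
        exact (H g).1 (h2 0 0)
      · intro H g
        have := fun h => H _ (edgesHold_of_premiseTerm G g 0 0 E h)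
        tauto
    · intro h
      refine premiseTerm_vars 0 0 E (h ▸ ?_)
      simp [USTerm.vars]

/-- A universal Horn sentence holds in `G` iff a certain identity holds in `A(G)`. -/
theorem exists_identity_of_uhSentence (Γ : UHSentence) :
    ∃ p : USTerm × USTerm, ∀ G : DirGraph.{u},
      (adjacencySemigroup G).SatisfiesIdentity p ↔ G.Satisfies Γ := by
  cases Γ with
  | horn P Φ =>
    obtain ⟨q, E, h⟩ := exists_eliminate_eq.{u} P
    have key : ∀ G : DirGraph.{u}, G.Satisfies (.horn P Φ) ↔
        ∀ v : ℕ → G.V, EdgesHold G v E → Φ.Realize (v ∘ q) := by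
      intro G
      constructor
      · intro H v hv
        exact H _ ((h G v).2 hv)
      · intro H v hv
        obtain ⟨h1, h2⟩ := (h G v).1 hv
        exact h1 ▸ H v h2
    simp only [key]
    cases Φ with
    | adj x y => exact exists_identity_of_edges_imp_adj E (q x) (q y)
    | eq x y => exact exists_identity_of_edges_imp_eq E (q x) (q y)
  | neg Φ P =>
    obtain ⟨q, E, h⟩ := exists_eliminate_eq.{u} (Φ :: P)
    have key : ∀ G : DirGraph.{u}, G.Satisfies (.neg Φ P) ↔
        ∀ v : ℕ → G.V, ¬ EdgesHold G v E := by
      intro G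
      rw [satisfies_neg_iff]
      exact ⟨fun H v hv => H _ ((h G v).2 hv), fun H v hv => H v ((h G v).1 hv).2⟩
    simp only [key]
    exact exists_identity_of_not_edges E

-- Transfer of theories and of finite bases

theorem satisfies_of_satisfiesIdentity {K : Set DirGraph.{u}} {G : DirGraph.{u}}
    (hG : ∀ p : USTerm × USTerm, (∀ T ∈ adjacencyClass K, T.SatisfiesIdentity p) →
      (adjacencySemigroup G).SatisfiesIdentity p)
    (Γ : UHSentence) (hΓ : ∀ H ∈ K, H.Satisfies Γ) : G.Satisfies Γ := by
  obtain ⟨p, hp⟩ := exists_identity_of_uhSentence.{u} Γ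
  refine (hp G).1 (hG p ?_)
  rintro _ ⟨H, hH, rfl⟩
  exact (hp H).2 (hΓ H hH)

theorem satisfiesIdentity_of_satisfies {K : Set DirGraph.{u}} {G : DirGraph.{u}}
    (hG : ∀ Γ : UHSentence, (∀ H ∈ K, H.Satisfies Γ) → G.Satisfies Γ)
    (p : USTerm × USTerm) (hp : ∀ T ∈ adjacencyClass K, T.SatisfiesIdentity p) :
    (adjacencySemigroup G).SatisfiesIdentity p := by
  obtain ⟨B, _, hB⟩ := exists_uhSentences_of_identity.{u} p
  refine (hB G).1 fun Γ hΓ => hG Γ fun H hH => ?_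
  exact (hB H).2 (hp _ ⟨H, hH, rfl⟩) Γ hΓ

/-- The identity basis is tested only on semigroups of the form `A(G)`, where each of its members
unfolds to finitely many universal Horn sentences. -/
theorem hasFiniteUHBasis_of_hasFiniteIdentityBasis {K : Set DirGraph.{u}}
    (h : HasFiniteIdentityBasis (adjacencyClass K)) : HasFiniteUHBasis K := by
  obtain ⟨B, hfin, hB⟩ := h
  choose σ hσ hσG using exists_uhSentences_of_identity.{u}
  refine ⟨⋃ p ∈ B, σ p, hfin.biUnion fun p _ => hσ p, fun G => ?_⟩
  have h1 : (∀ Γ ∈ ⋃ p ∈ B, σ p, G.Satisfies Γ) ↔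
      ∀ p ∈ B, (adjacencySemigroup G).SatisfiesIdentity p := by
    simp only [Set.mem_iUnion, ← hσG]
    exact ⟨fun H p hp Γ hΓ => H Γ ⟨p, hp, hΓ⟩, fun H Γ ⟨p, hp, hΓ⟩ => H p hp Γ hΓ⟩
  rw [h1, hB]
  exact ⟨satisfies_of_satisfiesIdentity, satisfiesIdentity_of_satisfies⟩

/-! ## Models of identities -/

theorem UnarySemigroup.IsHom.map_eval {S T : UnarySemigroup.{u}} {f : S.carrier → T.carrier}
    (hf : S.IsHom T f) (v : ℕ → S.carrier) (t : USTerm) :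
    f (t.eval S v) = t.eval T (f ∘ v) := by
  induction t with
  | var x => rfl
  | mul s t ihs iht => simp only [USTerm.eval, hf.map_mul, ihs, iht]
  | rev s ih => simp only [USTerm.eval, hf.map_rev, ih]

theorem UnarySemigroup.prod_isHom {I : Type u} (S : I → UnarySemigroup.{u}) (i : I) :
    (UnarySemigroup.prod S).IsHom (S i) (fun a => a i) :=
  ⟨fun _ _ => rfl, fun _ => rfl⟩

theorem isUSVariety_models (B : Set (USTerm × USTerm)) :
    IsUSVariety {S : UnarySemigroup.{u} | ∀ p ∈ B, S.SatisfiesIdentity p} where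
  image S T hS f hf hsurj p hp v := by
    obtain ⟨w, hw⟩ : ∃ w : ℕ → S.carrier, f ∘ w = v :=
      ⟨fun n => (hsurj (v n)).choose, funext fun n => (hsurj (v n)).choose_spec⟩
    rw [← hw, ← hf.map_eval, ← hf.map_eval, hS p hp w]
  sub S T hT f hf hinj p hp v := by
    apply hinj
    rw [hf.map_eval, hf.map_eval, hT p hp]
  prod I S hS p hp v := by
    funext i
    have h := UnarySemigroup.prod_isHom S i
    exact (h.map_eval v p.1).trans ((hS i p hp _).trans (h.map_eval v p.2).symm)

theorem satisfiesIdentity_of_mem_varietyGenerated {C : Set UnarySemigroup.{u}}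
    {S : UnarySemigroup.{u}} (hS : S ∈ varietyGenerated C) (p : USTerm × USTerm)
    (hp : ∀ T ∈ C, T.SatisfiesIdentity p) : S.SatisfiesIdentity p :=
  hS {S | ∀ q ∈ ({p} : Set (USTerm × USTerm)), S.SatisfiesIdentity q}
    ⟨isUSVariety_models _, fun T hT q hq => by rw [hq]; exact hp T hT⟩ p rfl

theorem isUSVariety_varietyGenerated (C : Set UnarySemigroup.{u}) :
    IsUSVariety (varietyGenerated C) where
  image S T hS f hf hs W hW := hW.1.image S T (hS W hW) f hf hs
  sub S T hT f hf hs W hW := hW.1.sub S T (hT W hW) f hf hs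
  prod I S hS W hW := hW.1.prod I S fun i => hS i W hW

theorem subset_varietyGenerated (C : Set UnarySemigroup.{u}) : C ⊆ varietyGenerated C :=
  fun _ hS _ hW => hW.2 hS

theorem varietyGenerated_subset {C W : Set UnarySemigroup.{u}} (hW : IsUSVariety W)
    (h : C ⊆ W) : varietyGenerated C ⊆ W :=
  fun _ hS => hS W ⟨hW, h⟩

/-! ## Graphs whose adjacency semigroup lies in a variety -/

theorem adjacencySemigroup_mem_of_isEmpty {W : Set UnarySemigroup.{u}} (hW : IsUSVariety W)
    (G : DirGraph.{u}) [IsEmpty G.V] : adjacencySemigroup G ∈ W := by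
  have hsub : ∀ a b : (adjacencySemigroup G).carrier, a = b := by
    rintro (_ | ⟨x, _⟩) (_ | ⟨y, _⟩)
    · rfl
    · exact isEmptyElim y
    · exact isEmptyElim x
    · exact isEmptyElim x
  -- Here `A(G)` is just 0, an image of the empty product.
  exact hW.image _ _ (hW.prod PEmpty (fun i => i.elim) fun i => i.elim)
    (fun _ => (AdjElem.zero : AdjElem G.V)) ⟨fun _ _ => hsub _ _, fun _ => hsub _ _⟩
    fun b => ⟨fun i => i.elim, hsub _ _⟩

theorem adjacencySemigroup_mem_of_embedding {W : Set UnarySemigroup.{u}} (hW : IsUSVariety W)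
    {G H : DirGraph.{u}} (e : G.Adj ↪r H.Adj) (hH : adjacencySemigroup H ∈ W) :
    adjacencySemigroup G ∈ W := by
  classical
  let f : AdjElem G.V → AdjElem H.V := fun a => match a with
    | .zero => .zero
    | .pair x y => .pair (e x) (e y)
  refine hW.sub _ _ hH f ⟨?_, ?_⟩ ?_
  · rintro (_ | ⟨x, y⟩) (_ | ⟨z, t⟩) <;> try rfl
    change f (AdjElem.mul G _ _) = AdjElem.mul H _ _
    by_cases h : G.Adj y z
    · simp [AdjElem.mul, f, h, e.map_rel_iff.2 h]
    · have h' : ¬ H.Adj (e y) (e z) := fun h' => h (e.map_rel_iff.1 h')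
      simp [AdjElem.mul, f, h, h']
  · rintro (_ | ⟨x, y⟩) <;> rfl
  · rintro (_ | ⟨x, y⟩) (_ | ⟨z, t⟩) h
    · rfl
    · cases h
    · cases h
    · have := (AdjElem.pair.injEq _ _ _ _).mp h
      rw [e.injective this.1, e.injective this.2]

-- Adjacency semigroups of reduced products

open Classical in
theorem AdjElem.pair_mul_pair (G : DirGraph.{u}) (x y z t : G.V) :
    AdjElem.mul G (.pair x y) (.pair z t) = if G.Adj y z then .pair x t else .zero := rfl

theorem AdjElem.rev_eq_zero_iff {V : Type u} (a : AdjElem V) : a.rev = .zero ↔ a = .zero := by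
  cases a <;> simp [AdjElem.rev]

/-- The left vertex, with a default value for `0`. -/
def AdjElem.left {V : Type u} (d : V) : AdjElem V → V
  | .zero => d
  | .pair x _ => x

/-- The right vertex, with a default value for `0`. -/
def AdjElem.right {V : Type u} (d : V) : AdjElem V → V
  | .zero => d
  | .pair _ y => y

theorem AdjElem.left_rev {V : Type u} (d : V) (a : AdjElem V) : a.rev.left d = a.right d := by
  cases a <;> rfl

theorem AdjElem.right_rev {V : Type u} (d : V) (a : AdjElem V) : a.rev.right d = a.left d := by
  cases a <;> rfl

theorem AdjElem.mul_ne_zero_iff (G : DirGraph.{u}) (d : G.V) (a b : AdjElem G.V) :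
    AdjElem.mul G a b ≠ .zero ↔
      a ≠ .zero ∧ b ≠ .zero ∧ G.Adj (a.right d) (b.left d) := by
  classical
  rcases a with _ | ⟨x, y⟩ <;> rcases b with _ | ⟨z, t⟩ <;>
    simp [AdjElem.mul, AdjElem.right, AdjElem.left]

theorem AdjElem.left_mul (G : DirGraph.{u}) (d : G.V) (a b : AdjElem G.V)
    (h : AdjElem.mul G a b ≠ .zero) :
    (AdjElem.mul G a b).left d = a.left d := by
  classical
  rcases a with _ | ⟨x, y⟩ <;> rcases b with _ | ⟨z, t⟩ <;> simp_all [AdjElem.mul, AdjElem.left]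

theorem AdjElem.right_mul (G : DirGraph.{u}) (d : G.V) (a b : AdjElem G.V)
    (h : AdjElem.mul G a b ≠ .zero) :
    (AdjElem.mul G a b).right d = b.right d := by
  classical
  rcases a with _ | ⟨x, y⟩ <;> rcases b with _ | ⟨z, t⟩ <;> simp_all [AdjElem.mul, AdjElem.right]

theorem DirGraph.ultraproduct_adj {I : Type u} (U : Ultrafilter I) (H : I → DirGraph.{u})
    (f g : ∀ i, (H i).V) :
    (DirGraph.ultraproduct U H).Adj (Quotient.mk _ f) (Quotient.mk _ g) ↔
      ∀ᶠ i in (U : Filter I), (H i).Adj (f i) (g i) := by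
  constructor
  · rintro ⟨f', g', hf, hg, h⟩
    have hf' : ∀ᶠ i in (U : Filter I), f i = f' i := Quotient.exact hf
    have hg' : ∀ᶠ i in (U : Filter I), g i = g' i := Quotient.exact hg
    filter_upwards [hf', hg', h] with i h1 h2 h3
    rwa [h1, h2]
  · exact fun h => ⟨f, g, rfl, rfl, h⟩

/-- If `P` is the reduced product of the graphs `H i` over a filter and all `A(H i)` lie in a
variety, then so does `A(P)`. -/
theorem adjacencySemigroup_mem_of_filter {W : Set UnarySemigroup.{u}} (hW : IsUSVariety W)
    {I : Type u} (F : Filter I) [F.NeBot] (H : I → DirGraph.{u})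
    (hH : ∀ i, adjacencySemigroup (H i) ∈ W) (P : DirGraph.{u}) (d : ∀ i, (H i).V)
    (π : (∀ i, (H i).V) → P.V) (hπ : Function.Surjective π)
    (hcongr : ∀ f g : ∀ i, (H i).V, (∀ᶠ i in F, f i = g i) → π f = π g)
    (hadj : ∀ f g : ∀ i, (H i).V, P.Adj (π f) (π g) ↔ ∀ᶠ i in F, (H i).Adj (f i) (g i)) :
    adjacencySemigroup P ∈ W := by
  classical
  let l : (∀ i, AdjElem (H i).V) → P.V := fun a => π fun i => (a i).left (d i)
  let r : (∀ i, AdjElem (H i).V) → P.V := fun a => π fun i => (a i).right (d i)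
  -- Families that are not `F`-eventually nonzero collapse to 0; the others keep their families of
  -- left and right vertices modulo `F`. Since `F` is closed under supersets and finite
  -- intersections, a product is eventually nonzero iff both factors are and the middle vertices are
  -- eventually adjacent. The default `d i` therefore never affects the result.
  let φ : (∀ i, AdjElem (H i).V) → AdjElem P.V := fun a =>
    if ∀ᶠ i in F, a i ≠ .zero then .pair (l a) (r a) else .zero
  have hpos : ∀ a, (∀ᶠ i in F, a i ≠ .zero) → φ a = .pair (l a) (r a) := fun a h => if_pos h
  have hneg : ∀ a, (¬ ∀ᶠ i in F, a i ≠ .zero) → φ a = .zero := fun a h => if_neg h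
  have hmul : ∀ a b : ∀ i, AdjElem (H i).V,
      φ (fun i => AdjElem.mul (H i) (a i) (b i)) = AdjElem.mul P (φ a) (φ b) := by
    intro a b
    by_cases hab : ∀ᶠ i in F, AdjElem.mul (H i) (a i) (b i) ≠ .zero
    · have ha : ∀ᶠ i in F, a i ≠ .zero :=
        hab.mono fun i h => ((AdjElem.mul_ne_zero_iff _ (d i) _ _).1 h).1
      have hb : ∀ᶠ i in F, b i ≠ .zero :=
        hab.mono fun i h => ((AdjElem.mul_ne_zero_iff _ (d i) _ _).1 h).2.1
      have hr : P.Adj (r a) (l b) := (hadj _ _).2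
        (hab.mono fun i h => ((AdjElem.mul_ne_zero_iff _ (d i) _ _).1 h).2.2)
      have h1 : l (fun i => AdjElem.mul (H i) (a i) (b i)) = l a :=
        hcongr _ _ (hab.mono fun i h => AdjElem.left_mul _ _ _ _ h)
      have h2 : r (fun i => AdjElem.mul (H i) (a i) (b i)) = r b :=
        hcongr _ _ (hab.mono fun i h => AdjElem.right_mul _ _ _ _ h)
      rw [hpos _ hab, hpos _ ha, hpos _ hb, AdjElem.pair_mul_pair, if_pos hr, h1, h2]
    · rw [hneg _ hab]
      by_cases ha : ∀ᶠ i in F, a i ≠ .zero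
      · by_cases hb : ∀ᶠ i in F, b i ≠ .zero
        · have hr : ¬ P.Adj (r a) (l b) := fun hr => hab <| by
            filter_upwards [ha, hb, (hadj _ _).1 hr] with i h1 h2 h3
            exact (AdjElem.mul_ne_zero_iff _ (d i) _ _).2 ⟨h1, h2, h3⟩
          rw [hpos _ ha, hpos _ hb, AdjElem.pair_mul_pair, if_neg hr]
        · rw [hneg _ hb, AdjElem.mul_zero]
      · rw [hneg _ ha, AdjElem.zero_mul]
  have hrev : ∀ a : ∀ i, AdjElem (H i).V, φ (fun i => (a i).rev) = (φ a).rev := by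
    intro a
    simp only [φ, l, r, ne_eq, AdjElem.rev_eq_zero_iff, AdjElem.left_rev, AdjElem.right_rev]
    split_ifs <;> rfl
  refine hW.image _ _ (hW.prod I (fun i => adjacencySemigroup (H i)) hH) φ ⟨hmul, hrev⟩ ?_
  rintro (_ | ⟨x, y⟩)
  -- Properness of `F` is needed here: the zero family must not count as eventually nonzero.
  · exact ⟨fun _ => AdjElem.zero, hneg _ (by simpa using Filter.NeBot.ne (f := F) inferInstance)⟩
  · obtain ⟨f, rfl⟩ := hπ x
    obtain ⟨g, rfl⟩ := hπ y
    exact ⟨fun i => AdjElem.pair (f i) (g i), hpos _ (by simp)⟩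

/-- Direct products and ultraproducts are the reduced products over `⊤` and over an ultrafilter. If
the product of the vertex sets is empty, no default family exists, but then the resulting graph is
empty too. -/
theorem isUHClass_adjacencySemigroup_mem {W : Set UnarySemigroup.{u}} (hW : IsUSVariety W) :
    IsUHClass {G : DirGraph.{u} | adjacencySemigroup G ∈ W} where
  nonempty := ⟨⟨PEmpty, ⟨fun _ _ => False⟩⟩,
    @adjacencySemigroup_mem_of_isEmpty _ hW _ (inferInstanceAs (IsEmpty PEmpty))⟩
  induced G H hH := fun ⟨e⟩ => adjacencySemigroup_mem_of_embedding hW e hH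
  prod I _ H hH := by
    rcases isEmpty_or_nonempty (∀ i, (H i).V) with h | ⟨⟨d⟩⟩
    · exact @adjacencySemigroup_mem_of_isEmpty _ hW (DirGraph.prod H) h
    · refine adjacencySemigroup_mem_of_filter hW ⊤ H hH (DirGraph.prod H) d id
        Function.surjective_id ?_ ?_
      · intro f g h
        exact funext (by simpa using h)
      · intro f g
        simp only [Filter.eventually_top]
        rfl
  ultraproduct I U H hH := by
    rcases isEmpty_or_nonempty (∀ i, (H i).V) with h | ⟨⟨d⟩⟩
    · have : IsEmpty (DirGraph.ultraproduct U H).V :=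
        ⟨fun a => Quotient.inductionOn a fun f => h.elim f⟩
      exact adjacencySemigroup_mem_of_isEmpty hW _
    · exact adjacencySemigroup_mem_of_filter hW U H hH (DirGraph.ultraproduct U H) d
        (Quotient.mk _) Quotient.mk_surjective (fun f g h => Quotient.sound h)
        (DirGraph.ultraproduct_adj U H)

theorem adjacencyClass_subset_of_subset {K M : Set DirGraph.{u}}
    (h : M ⊆ uhClassGenerated K) :
    adjacencyClass M ⊆ varietyGenerated (adjacencyClass K) := by
  rintro _ ⟨G, hG, rfl⟩
  exact h hG {G | adjacencySemigroup G ∈ varietyGenerated (adjacencyClass K)}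
    ⟨isUHClass_adjacencySemigroup_mem (isUSVariety_varietyGenerated _),
      fun H hH => subset_varietyGenerated _ ⟨H, hH, rfl⟩⟩

/-! ## Universal Horn classes are axiomatized by universal Horn sentences -/

/-- Finitely many vertices can be named by variables. -/
theorem exists_coding {V : Type u} [Nonempty V] (S : Finset V) :
    ∃ (e : ℕ → V) (c : V → ℕ), ∀ x ∈ S, e (c x) = x := by
  obtain ⟨n, ⟨f⟩⟩ : ∃ n, Nonempty (S ≃ Fin n) := ⟨_, ⟨S.equivFin⟩⟩
  classical
  refine ⟨fun k => if h : k < n then (f.symm ⟨k, h⟩ : V) else Classical.arbitrary V,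
    fun x => if h : x ∈ S then f ⟨x, h⟩ else 0, fun x hx => ?_⟩
  simp [hx]

/-- A map to a member of `M` can preserve finitely many edges of `G` and in addition either reflect
a given non-edge or separate two given vertices. -/
theorem exists_hom_on_finset {M : Set DirGraph.{u}} {G : DirGraph.{u}} [Nonempty G.V]
    (hG : ∀ Γ : UHSentence, (∀ H ∈ M, H.Satisfies Γ) → G.Satisfies Γ)
    (F : Finset (G.V × G.V)) (x y : G.V) :
    (∃ H ∈ M, ∃ h : G.V → H.V,
      (∀ p ∈ F, G.Adj p.1 p.2 → H.Adj (h p.1) (h p.2)) ∧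
        (¬ G.Adj x y → ¬ H.Adj (h x) (h y))) ∧
    (∃ H ∈ M, ∃ h : G.V → H.V,
      (∀ p ∈ F, G.Adj p.1 p.2 → H.Adj (h p.1) (h p.2)) ∧ (x ≠ y → h x ≠ h y)) := by
  classical
  obtain ⟨e, c, hc⟩ := exists_coding (insert x (insert y (F.image Prod.fst ∪ F.image Prod.snd)))
  have hx : e (c x) = x := hc x (by simp)
  have hy : e (c y) = y := hc y (by simp)
  have hF : ∀ p ∈ F, e (c p.1) = p.1 ∧ e (c p.2) = p.2 := fun p hp =>
    ⟨hc _ (by simp only [Finset.mem_insert, Finset.mem_union, Finset.mem_image]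
              exact .inr (.inr (.inl ⟨p, hp, rfl⟩))),
     hc _ (by simp only [Finset.mem_insert, Finset.mem_union, Finset.mem_image]
              exact .inr (.inr (.inr ⟨p, hp, rfl⟩)))⟩
  -- The edges of `G` listed in `F`, written in variables: a finite part of the positive diagram.
  let E : List (ℕ × ℕ) := (F.filter fun p => G.Adj p.1 p.2).toList.map fun p => (c p.1, c p.2)
  have hE : ∀ (H : DirGraph.{u}) (v : ℕ → H.V), EdgesHold H v E ↔
      ∀ p ∈ F, G.Adj p.1 p.2 → H.Adj (v (c p.1)) (v (c p.2)) := by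
    intro H v
    simp only [EdgesHold, E, List.mem_map, Finset.mem_toList, Finset.mem_filter]
    exact ⟨fun h p hp ha => h _ ⟨p, ⟨hp, ha⟩, rfl⟩, by rintro h _ ⟨p, ⟨hp, ha⟩, rfl⟩; exact h p hp ha⟩
  have hEG : EdgesHold G e E := (hE G e).2 fun p hp ha => by
    rwa [(hF p hp).1, (hF p hp).2]
  -- Otherwise the sentence `E → A` would hold throughout `M`, hence in `G`, where `e` refutes it.
  have horn : ∀ A : GraphAtom, ¬ A.Realize e → ∃ H ∈ M, ∃ v : ℕ → H.V,
      EdgesHold H v E ∧ ¬ A.Realize v := by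
    intro A hA
    by_contra! hcon
    refine hA ((satisfies_horn_edgeAtoms G E A).1 (hG _ fun H hH => ?_) e hEG)
    exact (satisfies_horn_edgeAtoms H E A).2 fun v hv => hcon H hH v hv
  -- When there is nothing to reflect or separate, a negative sentence supplies the target; for
  -- empty `E` it still guarantees a nonempty one.
  have hneg : ∃ H ∈ M, ∃ v : ℕ → H.V, EdgesHold H v E := by
    by_contra! hcon
    refine (satisfies_neg_edgeAtoms G E).1 (hG _ fun H hH => ?_) e hEG
    exact (satisfies_neg_edgeAtoms H E).2 fun v hv => hcon H hH v hv
  constructor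
  · by_cases hxy : G.Adj x y
    · obtain ⟨H, hH, v, hv⟩ := hneg
      exact ⟨H, hH, v ∘ c, (hE H v).1 hv, fun h => absurd hxy h⟩
    · obtain ⟨H, hH, v, hv, hA⟩ := horn (.adj (c x) (c y)) (by
        simpa only [GraphAtom.realize_adj, GraphAtom.realize_eq, hx, hy] using hxy)
      exact ⟨H, hH, v ∘ c, (hE H v).1 hv, fun _ => hA⟩
  · by_cases hxy : x = y
    · obtain ⟨H, hH, v, hv⟩ := hneg
      exact ⟨H, hH, v ∘ c, (hE H v).1 hv, fun h => absurd hxy h⟩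
    · obtain ⟨H, hH, v, hv, hA⟩ := horn (.eq (c x) (c y)) (by
        simpa only [GraphAtom.realize_adj, GraphAtom.realize_eq, hx, hy] using hxy)
      exact ⟨H, hH, v ∘ c, (hE H v).1 hv, fun _ => hA⟩

/-- Maps that preserve finitely many edges can be combined into a homomorphism to an
ultraproduct. -/
theorem exists_hom_of_forall_finset {M : Set DirGraph.{u}} (hM : IsUHClass M) {G : DirGraph.{u}}
    (Q : ∀ H : DirGraph.{u}, (G.V → H.V) → Prop)
    (hQ : ∀ F : Finset (G.V × G.V), ∃ H ∈ M, ∃ h : G.V → H.V,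
      (∀ p ∈ F, G.Adj p.1 p.2 → H.Adj (h p.1) (h p.2)) ∧ Q H h)
    (hU : ∀ (I : Type u) (U : Ultrafilter I) (H : I → DirGraph.{u}) (h : ∀ i, G.V → (H i).V),
      (∀ i, Q (H i) (h i)) →
        Q (DirGraph.ultraproduct U H) fun a => Quotient.mk _ fun i => h i a) :
    ∃ H ∈ M, ∃ h : G.V → H.V, (∀ a b, G.Adj a b → H.Adj (h a) (h b)) ∧ Q H h := by
  classical
  choose H hH h hadj hq using hQ
  -- Compactness: an ultrafilter below `atTop` contains, for each pair, the set of all `F` having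
  -- that pair as a member, so each edge is preserved almost everywhere.
  let U : Ultrafilter (Finset (G.V × G.V)) := Ultrafilter.of Filter.atTop
  refine ⟨DirGraph.ultraproduct U H, hM.ultraproduct _ U H hH,
    fun a => Quotient.mk _ fun i => h i a, fun a b hab => ?_, hU _ U H h hq⟩
  refine (DirGraph.ultraproduct_adj U H _ _).2 ?_
  have : ∀ᶠ F in Filter.atTop, {(a, b)} ≤ (F : Finset (G.V × G.V)) := Filter.eventually_ge_atTop _
  filter_upwards [Ultrafilter.of_le _ this] with F hF
  exact hadj F (a, b) (hF (by simp)) hab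

/-- A graph satisfying all universal Horn sentences of a universal Horn class belongs to it. -/
theorem IsUHClass.mem_of_satisfies {M : Set DirGraph.{u}} (hM : IsUHClass M) {G : DirGraph.{u}}
    (hG : ∀ Γ : UHSentence, (∀ H ∈ M, H.Satisfies Γ) → G.Satisfies Γ) : G ∈ M := by
  rcases isEmpty_or_nonempty G.V with hV | hV
  · obtain ⟨H, hH⟩ := hM.nonempty
    exact hM.induced G H hH ⟨⟨⟨isEmptyElim, fun x => isEmptyElim x⟩, fun {x} => isEmptyElim x⟩⟩
  -- One homomorphism for each pair of vertices and each task: `true` reflects a non-edge, `false`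
  -- separates distinct vertices. Their joint map into the product is then an embedding; the index
  -- set is nonempty because `G` is.
  have key : ∀ j : G.V × G.V × Bool, ∃ H ∈ M, ∃ h : G.V → H.V,
      (∀ a b, G.Adj a b → H.Adj (h a) (h b)) ∧
        (j.2.2 = true → ¬ G.Adj j.1 j.2.1 → ¬ H.Adj (h j.1) (h j.2.1)) ∧
        (j.2.2 = false → j.1 ≠ j.2.1 → h j.1 ≠ h j.2.1) := by
    rintro ⟨x, y, _ | _⟩
    · obtain ⟨H, hH, h, h1, h2⟩ := exists_hom_of_forall_finset hM
        (fun H h => x ≠ y → h x ≠ h y) (fun F => (exists_hom_on_finset hG F x y).2) (by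
          intro I U H h hq hxy heq
          obtain ⟨i, hi⟩ := Filter.Eventually.exists
            (show ∀ᶠ i in (U : Filter I), h i x = h i y from Quotient.exact heq)
          exact hq i hxy hi)
      exact ⟨H, hH, h, h1, by simp, fun _ => h2⟩
    · obtain ⟨H, hH, h, h1, h2⟩ := exists_hom_of_forall_finset hM
        (fun H h => ¬ G.Adj x y → ¬ H.Adj (h x) (h y))
        (fun F => (exists_hom_on_finset hG F x y).1) (by
          intro I U H h hq hxy hadj
          obtain ⟨i, hi⟩ := ((DirGraph.ultraproduct_adj U H _ _).1 hadj).exists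
          exact hq i hxy hi)
      exact ⟨H, hH, h, h1, fun _ => h2, by simp⟩
  choose H hH h hadj hnadj hne using key
  refine hM.induced G (DirGraph.prod H) (hM.prod _ H hH) ⟨⟨⟨fun a j => h j a, ?_⟩, ?_⟩⟩
  · intro a b hab
    by_contra hc
    exact hne (a, b, false) rfl hc (congrFun hab (a, b, false))
  · intro a b
    constructor
    · intro hab
      by_contra hc
      exact hnadj (a, b, true) rfl hc (hab (a, b, true))
    · exact fun hab j => hadj j a b hab

-- Embedding universal Horn classes into subvarieties

theorem IsUHClass.mem_of_adjacencySemigroup_mem {M : Set DirGraph.{u}} (hM : IsUHClass M)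
    {G : DirGraph.{u}} (hG : adjacencySemigroup G ∈ varietyGenerated (adjacencyClass M)) :
    G ∈ M :=
  hM.mem_of_satisfies
    (satisfies_of_satisfiesIdentity fun p hp => satisfiesIdentity_of_mem_varietyGenerated hG p hp)

/-- A universal Horn class `M` is recovered from its variety as the class of graphs whose adjacency
semigroup lies there. -/
theorem injOn_varietyGenerated_adjacencyClass (L : Set DirGraph.{u}) :
    Set.InjOn (fun M => varietyGenerated (adjacencyClass M)) (subUHClasses L) := by
  have key : ∀ M N : Set DirGraph.{u}, IsUHClass N →
      varietyGenerated (adjacencyClass M) = varietyGenerated (adjacencyClass N) → M ⊆ N :=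
    fun M N hN h G hG => hN.mem_of_adjacencySemigroup_mem
      (h ▸ subset_varietyGenerated _ ⟨G, hG, rfl⟩)
  exact fun M hM N hN h => (key M N hN.1 h).antisymm (key N M hM.1 h.symm)

theorem mapsTo_varietyGenerated_adjacencyClass (K : Set DirGraph.{u}) :
    Set.MapsTo (fun M => varietyGenerated (adjacencyClass M)) (subUHClasses (uhClassGenerated K))
      (subvarieties (varietyGenerated (adjacencyClass K))) :=
  fun _ hM => ⟨isUSVariety_varietyGenerated _,
    varietyGenerated_subset (isUSVariety_varietyGenerated _)
      (adjacencyClass_subset_of_subset hM.2)⟩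

theorem proposition5 (K : Set DirGraph.{u}) :
    (¬ HasFiniteUHBasis K → ¬ HasFiniteIdentityBasis (adjacencyClass K)) ∧
    ((subUHClasses (uhClassGenerated K)).Infinite →
      (subvarieties (varietyGenerated (adjacencyClass K))).Infinite) ∧
    (¬ (subUHClasses (uhClassGenerated K)).Countable →
      ¬ (subvarieties (varietyGenerated (adjacencyClass K))).Countable) := by
  refine ⟨mt hasFiniteUHBasis_of_hasFiniteIdentityBasis, fun h => ?_, mt fun h => ?_⟩
  · exact Set.infinite_of_injOn_mapsTo (injOn_varietyGenerated_adjacencyClass _)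
      (mapsTo_varietyGenerated_adjacencyClass K) h
  · exact (mapsTo_varietyGenerated_adjacencyClass K).countable_of_injOn
      (injOn_varietyGenerated_adjacencyClass _) h
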